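/- Let $\Gamma$ be a countably infinite discrete group and let $f=\sum_\gamma f_\gamma\cdot\gamma\in\mathbb Z[\Gamma]$. Put $\mathbb T=\mathbb R/\mathbb Z$, let $$X_f=\Bigl\{x\in\mathbb T^\Gamma : \sum_{\gamma\in\Gamma} f_\gamma x_{\gamma'\gamma}=0\ \text{for every } \gamma'\in\Gamma\Bigr\},$$ a closed subgroup of the compact group $\mathbb T^\Gamma$, and let $\alpha_f$ be the action of $\Gamma$ on $X_f$ by the left shifts $(\alpha_f^\gamma x)_{\gamma'}=x_{\gamma^{-1}\gamma'}$. The action $\alpha_f$ is called expansive if there is a neighbourhood $U$ of $0$ in $X_f$ with $\bigcap_{\gamma\in\Gamma}\alpha_f^\gamma(U)=\{0\}$. (Equivalently: for an invariant metric $d$ on $X_f$ defining the topology there is $\varepsilon>0$ with $\sup_{\gamma}d(\alpha_f^\gamma x,\alpha_f^\gamma y)\ge\varepsilon$ for all distinct $x,y\in X_f$.) An element $g\in\mathbb Z[\Gamma]$ is lopsided if there is a $\gamma_0\in\Gamma$ with $|g_{\gamma_0}|>\sum_{\gamma\ne\gamma_0}|g_\gamma|$. Let $f^*=\sum_\gamma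 f_\gamma\cdot\gamma^{-1}$, and let $*$ denote convolution, $(v*w)_{\delta}=\sum_{\gamma}v_\gamma w_{\gamma^{-1}\delta}$. The following statements are equivalent: 1. $\alpha_f$ is expansive; 2. $f$ is invertible in the convolution algebra $\ell^1(\Gamma,\mathbb R)$; 3. $K_\infty(f):=\{v\in\ell^\infty(\Gamma,\mathbb C) : v*f^*=0\}=\{0\}$; 4. the left ideal $\mathbb Z[\Gamma]f$ and the right ideal $f\mathbb Z[\Gamma]$ both contain lopsided elements. -/

import Mathlib

open scoped Topology ENNReal

namespace GroupRingDynamics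

noncomputable section

/-- The integral group ring `ℤ[Γ]`. -/
abbrev ZG (Γ : Type*) [Group Γ] : Type _ := MonoidAlgebra ℤ Γ

/-- An algebraic `Γ`-action: a homomorphism from `Γ` to the group of continuous automorphisms
of a compact second countable (Hausdorff) abelian group `X`. -/
structure AlgebraicAction (Γ X : Type*) [Group Γ] [AddCommGroup X] [TopologicalSpace X]
    [IsTopologicalAddGroup X] [CompactSpace X] [T2Space X] [SecondCountableTopology X] where
  /-- the automorphism `α^γ` -/
  aut : Γ → (X ≃ₜ+ X)
  aut_mul : ∀ (γ γ' : Γ) (x : X), aut (γ * γ') x = aut γ (aut γ' x)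

section Expansive

variable {Γ X : Type*} [Group Γ] [AddCommGroup X]

/-- An algebraic action is expansive if some neighbourhood `U` of `0` satisfies
`⋂ γ, α γ (U) = {0}`. -/
def AlgebraicAction.IsExpansive [TopologicalSpace X]
    [IsTopologicalAddGroup X] [CompactSpace X] [T2Space X] [SecondCountableTopology X]
    (α : AlgebraicAction Γ X) : Prop :=
  ∃ U ∈ 𝓝 (0 : X), ⋂ γ : Γ, (α.aut γ) '' U = {0}

/-- The metric form of expansiveness: for every invariant metric `d` defining the topology,
expansiveness means that `sup_γ d (α γ x) (α γ y)` is bounded below by a fixed `ε > 0` for all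
distinct `x, y`. -/
theorem AlgebraicAction.isExpansive_iff_dist [MetricSpace X]
    [IsTopologicalAddGroup X] [CompactSpace X] [SecondCountableTopology X]
    (hd : ∀ x y z : X, dist (x + z) (y + z) = dist x y) (α : AlgebraicAction Γ X) :
    α.IsExpansive ↔
      ∃ ε > 0, ∀ x y : X, x ≠ y → ε ≤ ⨆ γ : Γ, dist (α.aut γ x) (α.aut γ y) := by
  have hsub : ∀ (γ : Γ) (x y : X), dist (α.aut γ x) (α.aut γ y) = dist (α.aut γ (x - y)) 0 := by
    intro γ x y
    rw [map_sub, ← hd (α.aut γ x - α.aut γ y) 0 (α.aut γ y)]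
    simp
  have hbdd : ∀ x y : X, BddAbove (Set.range fun γ : Γ => dist (α.aut γ x) (α.aut γ y)) := by
    intro x y
    refine ⟨Metric.diam (Set.univ : Set X), ?_⟩
    rintro _ ⟨γ, rfl⟩
    exact Metric.dist_le_diam_of_mem isCompact_univ.isBounded (Set.mem_univ _) (Set.mem_univ _)
  have hone : ∀ x : X, α.aut 1 x = x := by
    intro x
    apply (α.aut 1).injective
    rw [← α.aut_mul, one_mul]
  have hinv : ∀ (γ : Γ) (x : X), α.aut γ (α.aut γ⁻¹ x) = x := by
    intro γ x
    rw [← α.aut_mul, mul_inv_cancel, hone]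
  constructor
  · rintro ⟨U, hU, h⟩
    obtain ⟨ε, hε, hball⟩ := Metric.mem_nhds_iff.1 hU
    refine ⟨ε, hε, fun x y hxy => ?_⟩
    by_contra! hlt
    apply hxy
    rw [← sub_eq_zero, ← Set.mem_singleton_iff, ← h, Set.mem_iInter]
    intro γ
    refine ⟨α.aut γ⁻¹ (x - y), hball ?_, hinv _ _⟩
    rw [Metric.mem_ball, ← hsub]
    exact (le_ciSup (hbdd x y) γ⁻¹).trans_lt hlt
  · rintro ⟨ε, hε, h⟩
    refine ⟨Metric.ball 0 (ε / 2), Metric.ball_mem_nhds _ (by positivity), ?_⟩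
    ext z
    rw [Set.mem_iInter, Set.mem_singleton_iff]
    constructor
    · intro hz
      by_contra hne
      have h1 := h z 0 hne
      have h2 : ⨆ γ : Γ, dist (α.aut γ z) (α.aut γ 0) ≤ ε / 2 := by
        refine ciSup_le fun γ => ?_
        obtain ⟨u, hu, huz⟩ := hz γ⁻¹
        have : α.aut γ z = u := by
          rw [← huz]; exact hinv γ u
        rw [this, map_zero]
        exact le_of_lt hu
      linarith
    · rintro rfl γ
      exact ⟨0, Metric.mem_ball_self (by positivity), map_zero _⟩

end Expansive

section Principal

variable {Γ : Type*} [Group Γ]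

/-- The action `(ρ^f x)_δ = ∑_γ f_γ x_{δγ}` of `f ∈ ℤ[Γ]` on `A^Γ`, `A` an abelian group,
extending the right shift. It is used for `A = ℝ/ℤ` and `A = ℂ`. -/
def rho {A : Type*} [AddCommGroup A] (f : ZG Γ) : (Γ → A) →+ (Γ → A) where
  toFun x := fun δ => f.coeff.sum fun γ n => n • x (δ * γ)
  map_zero' := by ext; simp
  map_add' x y := by ext; simp [Finsupp.sum, Finset.sum_add_distrib]

/-- The compact group `X_f = ker ρ^f ⊆ (ℝ/ℤ)^Γ`. -/
def X (f : ZG Γ) : AddSubgroup (Γ → UnitAddCircle) := (rho f).ker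

theorem continuous_rho {A : Type*} [AddCommGroup A] [TopologicalSpace A]
    [IsTopologicalAddGroup A] (f : ZG Γ) : Continuous (rho (A := A) f) := by
  refine continuous_pi fun δ => ?_
  change Continuous fun x : Γ → A => f.coeff.sum fun γ n => n • x (δ * γ)
  unfold Finsupp.sum
  fun_prop

theorem isClosed_X (f : ZG Γ) : IsClosed (X f : Set (Γ → UnitAddCircle)) :=
  isClosed_singleton.preimage (continuous_rho f)

instance (f : ZG Γ) : CompactSpace (X f) := isCompact_iff_compactSpace.1 (isClosed_X f).isCompact

instance : SecondCountableTopology UnitAddCircle := secondCountable_of_proper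

instance [Countable Γ] (f : ZG Γ) : SecondCountableTopology (X f) :=
  inferInstanceAs (SecondCountableTopology (X f : Set (Γ → UnitAddCircle)))

/-- The left shift `(λ^γ x)_δ = x_{γ⁻¹δ}` on `(ℝ/ℤ)^Γ`. -/
def shift (γ : Γ) (x : Γ → UnitAddCircle) : Γ → UnitAddCircle := fun δ => x (γ⁻¹ * δ)

theorem shift_mem (f : ZG Γ) (γ : Γ) {x : Γ → UnitAddCircle} (hx : x ∈ X f) :
    shift γ x ∈ X f := by
  have h : rho f x = 0 := hx
  change rho f (shift γ x) = 0
  ext δ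
  simpa [rho, shift, mul_assoc] using congrFun h (γ⁻¹ * δ)

theorem continuous_shift (γ : Γ) : Continuous (shift γ) :=
  continuous_pi fun δ => continuous_apply (γ⁻¹ * δ)

/-- The automorphism `α_f^γ` of `X_f`: the restriction of the left shift. -/
def principalAut (f : ZG Γ) (γ : Γ) : X f ≃ₜ+ X f where
  toFun x := ⟨shift γ x, shift_mem f γ x.2⟩
  invFun x := ⟨shift γ⁻¹ x, shift_mem f γ⁻¹ x.2⟩
  left_inv x := by ext δ; simp [shift]
  right_inv x := by ext δ; simp [shift]
  map_add' x y := rfl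
  continuous_toFun := ((continuous_shift γ).comp continuous_subtype_val).subtype_mk _
  continuous_invFun := ((continuous_shift γ⁻¹).comp continuous_subtype_val).subtype_mk _

/-- The principal algebraic `Γ`-action `(X_f, α_f)`. -/
def principalAction [Countable Γ] (f : ZG Γ) : AlgebraicAction Γ (X f) where
  aut := principalAut f
  aut_mul γ γ' x := by
    ext δ
    change x.1 ((γ * γ')⁻¹ * δ) = x.1 (γ'⁻¹ * (γ⁻¹ * δ))
    simp [mul_assoc]

end Principal

section Convolution

variable {Γ : Type*} [Group Γ]

/-- Convolution `(v * w)_δ = ∑_γ v_γ w_{γ⁻¹δ}`. It is only used where one factor is summable and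
the other one bounded, so that the series converges absolutely. -/
def conv {K : Type*} [RCLike K] (v w : Γ → K) : Γ → K := fun δ => ∑' γ : Γ, v γ * w (γ⁻¹ * δ)

/-- The coefficient family of an element of `ℤ[Γ]`, with values in `K = ℝ` or `ℂ`. -/
def coeffs (K : Type*) [RCLike K] (f : ZG Γ) : Γ → K := fun γ => (f.coeff γ : K)

/-- `f` is invertible in the convolution algebra `ℓ¹(Γ, ℝ)`. -/
def InvertibleInL1 (f : ZG Γ) : Prop :=
  ∃ w : lp (fun _ : Γ => ℝ) 1,
    conv (coeffs ℝ f) w = coeffs ℝ (1 : ZG Γ) ∧ conv w (coeffs ℝ f) = coeffs ℝ (1 : ZG Γ)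

/-- The adjoint `f* = ∑ f_γ γ⁻¹`. -/
def adjoint (f : ZG Γ) : ZG Γ := .ofCoeff (f.coeff.equivMapDomain (Equiv.inv Γ))

/-- `ρ^f v = v * f*`. -/
theorem rho_eq_conv_adjoint {K : Type*} [RCLike K] (f : ZG Γ) (v : Γ → K) :
    rho f v = conv v (coeffs K (adjoint f)) := by
  ext δ
  have h : conv v (coeffs K (adjoint f)) δ
      = ∑' γ : Γ, (f.coeff γ : K) * v (δ * γ) := by
    unfold conv
    rw [← (Equiv.mulLeft δ).tsum_eq (fun γ => v γ * coeffs K (adjoint f) (γ⁻¹ * δ))]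
    simp [coeffs, adjoint, mul_comm]
  rw [h, tsum_eq_sum (s := f.coeff.support)]
  · simp [rho, Finsupp.sum]
  · intro γ hγ
    simp [Finsupp.notMem_support_iff.1 hγ]

/-- `K_∞(f) = {v ∈ ℓ^∞(Γ, ℂ) : ρ^f v = v * f* = 0}`. -/
def KInfty (f : ZG Γ) : Submodule ℂ (lp (fun _ : Γ => ℂ) ∞) where
  carrier := {v | conv (v : Γ → ℂ) (coeffs ℂ (adjoint f)) = 0}
  zero_mem' := by
    rw [Set.mem_ofPred_eq, ← rho_eq_conv_adjoint]; exact map_zero _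
  add_mem' := by
    intro v w hv hw
    rw [Set.mem_ofPred_eq, ← rho_eq_conv_adjoint] at *
    rw [lp.coeFn_add, map_add, hv, hw, add_zero]
  smul_mem' := by
    intro c v hv
    rw [Set.mem_ofPred_eq, ← rho_eq_conv_adjoint] at *
    have : rho f (⇑(c • v)) = c • rho f (⇑v) := by
      ext δ; simp [rho, Finsupp.sum, Finset.mul_sum, mul_left_comm]
    rw [this, hv, smul_zero]

open Classical in
/-- `g` is lopsided: one coefficient strictly dominates the sum of all the others in modulus. -/
def IsLopsided (g : ZG Γ) : Prop :=
  ∃ γ₀ : Γ, ∑ γ ∈ g.coeff.support \ {γ₀}, |g.coeff γ| < |g.coeff γ₀|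

end Convolution

end

end GroupRingDynamics

/-! Expansiveness is matched with `K_∞(f) = 0` by lifting along `ℝ → ℝ/ℤ`. A point of `X_f` with
uniformly small coordinates lifts to a bounded real `r` for which `ρ^f r` is integer valued and of
modulus below 1, hence zero. Conversely, a small multiple of a bounded solution projects to a point
of `X_f` whose whole orbit stays near 0.

Since `ℓ^∞` is dual to `ℓ¹`, `K_∞(f) = 0` puts the unit mass `δ₁` in the `ℓ¹`-closure of `ℝ[Γ]f`
(`delta_mem_closure_of_KInfty_eq_bot`). Rounding the coefficients of a large multiple of an
approximation yields a lopsided `h * f`. A lopsided element is a dominant monomial plus a smaller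
perturbation, so it acts invertibly on every `ℓ^p` (`isUnit_leftConv`), and `f` acquires a left
inverse. That this inverse is two-sided is the heart of the proof: a trace argument on `ℓ²`
(`leftConv_apply_of_leftInverse`).

An inverse `w` in `ℓ¹` puts `δ₁ = w * f = f * w` in the closure of both ideals, and rounding gives
lopsided elements on both sides. Finally, a lopsided `h * f` kills no nonzero bounded family, and
`K_∞(f) ⊆ K_∞(h * f)`. -/

namespace GroupRingDynamics

noncomputable section

/-! ### Permutations of the index set acting isometrically on `ℓ^p` -/

section Translations

variable {ι : Type*} {p : ℝ≥0∞} [Fact (1 ≤ p)]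

theorem memℓp_comp_perm (σ : Equiv.Perm ι) {x : ι → ℝ} (hx : Memℓp x p) :
    Memℓp (fun i => x (σ i)) p := by
  rcases eq_or_ne p ∞ with rfl | hp
  · rw [memℓp_infty_iff] at hx ⊢
    exact hx.mono (by rintro _ ⟨i, rfl⟩; exact ⟨σ i, rfl⟩)
  · have hp0 : 0 < p.toReal :=
      ENNReal.toReal_pos (zero_lt_one.trans_le Fact.out).ne' hp
    rw [memℓp_gen_iff hp0] at hx ⊢
    exact (Equiv.summable_iff σ (f := fun i => ‖x i‖ ^ p.toReal)).2 hx

theorem lp_norm_eq_of_perm (σ : Equiv.Perm ι) (x y : lp (fun _ : ι => ℝ) p)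
    (h : ∀ i, y i = x (σ i)) : ‖y‖ = ‖x‖ := by
  rcases eq_or_ne p ∞ with rfl | hp
  · rw [lp.norm_eq_ciSup, lp.norm_eq_ciSup]
    simp_rw [h]
    exact σ.iSup_comp (g := fun i => ‖x i‖)
  · have hp0 : 0 < p.toReal :=
      ENNReal.toReal_pos (zero_lt_one.trans_le Fact.out).ne' hp
    rw [lp.norm_eq_tsum_rpow hp0, lp.norm_eq_tsum_rpow hp0]
    simp_rw [h]
    rw [σ.tsum_eq (fun i => ‖x i‖ ^ p.toReal)]

variable (p) in
/-- The isometry of `ℓ^p` induced by a permutation of the index set. -/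
def permIsometry (σ : Equiv.Perm ι) : lp (fun _ : ι => ℝ) p →ₗᵢ[ℝ] lp (fun _ : ι => ℝ) p where
  toFun x := ⟨fun i => x (σ.symm i), memℓp_comp_perm σ.symm (lp.memℓp x)⟩
  map_add' _ _ := rfl
  map_smul' _ _ := rfl
  norm_map' _ := lp_norm_eq_of_perm σ.symm _ _ fun _ => rfl

variable (p) in
/-- The action of the permutations of the index set on `ℓ^p` by bounded operators. -/
def permHom : Equiv.Perm ι →* (lp (fun _ : ι => ℝ) p →L[ℝ] lp (fun _ : ι => ℝ) p) where
  toFun σ := (permIsometry p σ).toContinuousLinearMap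
  map_one' := rfl
  map_mul' _ _ := rfl

theorem permHom_apply (σ : Equiv.Perm ι) (x : lp (fun _ : ι => ℝ) p) (i : ι) :
    permHom p σ x i = x (σ.symm i) := rfl

theorem norm_permHom_le (σ : Equiv.Perm ι) : ‖permHom (ι := ι) p σ‖ ≤ 1 :=
  (permIsometry p σ).norm_toContinuousLinearMap_le

open Classical in
theorem permHom_single (σ : Equiv.Perm ι) (i : ι) (a : ℝ) :
    permHom p σ (lp.single p i a) = lp.single p (σ i) a := by
  ext j
  rw [permHom_apply, lp.single_apply, lp.single_apply]
  simp [Pi.single_apply, Equiv.symm_apply_eq]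

end Translations

/-! ### Convolution operators on `ℓ^p` and invertibility of lopsided elements -/

section Operators

variable {Γ : Type*} [Group Γ] (p : ℝ≥0∞) [Fact (1 ≤ p)]

/-- The left regular representation on `ℓ^p`. -/
def leftShift : Γ →* (lp (fun _ : Γ => ℝ) p →L[ℝ] lp (fun _ : Γ => ℝ) p) :=
  (permHom p).comp (MulAction.toPermHom Γ Γ)

/-- The right translation `(R_γ x)_δ = x_{δγ⁻¹}` on `ℓ^p`. -/
def rightShift (γ : Γ) : lp (fun _ : Γ => ℝ) p →L[ℝ] lp (fun _ : Γ => ℝ) p :=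
  permHom p (Equiv.mulRight γ)

/-- Left convolution by an element of `ℤ[Γ]` on `ℓ^p`. -/
def leftConv : ZG Γ →ₐ[ℤ] (lp (fun _ : Γ => ℝ) p →L[ℝ] lp (fun _ : Γ => ℝ) p) :=
  MonoidAlgebra.lift ℤ _ Γ (leftShift p)

/-- Right convolution by an element of `ℤ[Γ]` on `ℓ^p`. -/
def rightConv (f : ZG Γ) : lp (fun _ : Γ => ℝ) p →L[ℝ] lp (fun _ : Γ => ℝ) p :=
  f.coeff.sum fun γ n => n • rightShift p γ

open Classical in
/-- The unit mass at `γ`. -/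
def delta (γ : Γ) : lp (fun _ : Γ => ℝ) p := lp.single p γ 1

variable {p}

omit [Group Γ] [Fact (1 ≤ p)] in
open Classical in
theorem delta_apply (γ δ : Γ) : delta p γ δ = if δ = γ then 1 else 0 := by
  rw [delta, lp.single_apply]
  simp [Pi.single_apply]

theorem rightShift_apply (γ : Γ) (x : lp (fun _ : Γ => ℝ) p) (δ : Γ) :
    rightShift p γ x δ = x (δ * γ⁻¹) := rfl

theorem leftShift_delta (γ δ : Γ) : leftShift p γ (delta p δ) = delta p (γ * δ) :=
  permHom_single _ _ _

theorem rightShift_delta (γ δ : Γ) : rightShift p γ (delta p δ) = delta p (δ * γ) :=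
  permHom_single _ _ _

theorem leftConv_eq_sum (f : ZG Γ) :
    leftConv p f = f.coeff.sum fun γ n => n • leftShift p γ :=
  MonoidAlgebra.lift_apply ..

theorem leftConv_apply (f : ZG Γ) (x : lp (fun _ : Γ => ℝ) p) (δ : Γ) :
    leftConv p f x δ = f.coeff.sum fun γ n => (n : ℝ) * x (γ⁻¹ * δ) := by
  rw [leftConv_eq_sum, Finsupp.sum, sum_apply, lp.coeFn_sum, Finset.sum_apply]
  refine Finset.sum_congr rfl fun γ _ => ?_
  rw [← Int.cast_smul_eq_zsmul ℝ]
  rfl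

theorem rightConv_apply (f : ZG Γ) (x : lp (fun _ : Γ => ℝ) p) (δ : Γ) :
    rightConv p f x δ = f.coeff.sum fun γ n => (n : ℝ) * x (δ * γ⁻¹) := by
  rw [rightConv, Finsupp.sum, sum_apply, lp.coeFn_sum, Finset.sum_apply]
  refine Finset.sum_congr rfl fun γ _ => ?_
  rw [← Int.cast_smul_eq_zsmul ℝ]
  rfl

theorem conv_coeffs_left (f : ZG Γ) (x : lp (fun _ : Γ => ℝ) p) :
    conv (coeffs ℝ f) x = leftConv p f x := by
  ext δ
  rw [leftConv_apply, conv, tsum_eq_sum (s := f.coeff.support)]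
  · rfl
  · intro γ hγ
    simp [coeffs, Finsupp.notMem_support_iff.1 hγ]

theorem conv_coeffs_right (f : ZG Γ) (x : lp (fun _ : Γ => ℝ) p) :
    conv x (coeffs ℝ f) = rightConv p f x := by
  ext δ
  rw [rightConv_apply, conv, ← ((Equiv.inv Γ).trans (Equiv.mulLeft δ)).tsum_eq,
    tsum_eq_sum (s := f.coeff.support)]
  · simp [coeffs, Finsupp.sum, mul_comm]
  · intro γ hγ
    simp [coeffs, Finsupp.notMem_support_iff.1 hγ]

omit [Fact (1 ≤ p)] in
theorem coeffs_one : coeffs ℝ (1 : ZG Γ) = delta p 1 := by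
  classical
  ext δ
  simp [coeffs, MonoidAlgebra.one_def, delta_apply, Finsupp.single_apply, eq_comm]

/-- With `rightConv_delta_one`, this gives the trace property: for `A` commuting with right
translations and `τ(A) = (A δ₁)₁`, left convolution `T` by `f` satisfies `τ(T A) = τ(A T)`, because
`A` commutes with `rightConv`. -/
theorem rightConv_apply_one (f : ZG Γ) (x : lp (fun _ : Γ => ℝ) p) :
    rightConv p f x 1 = leftConv p f x 1 := by
  simp [leftConv_apply, rightConv_apply]

theorem rightConv_delta_one (f : ZG Γ) :
    rightConv p f (delta p 1) = leftConv p f (delta p 1) := by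
  simp [leftConv_eq_sum, rightConv, Finsupp.sum,
    leftShift_delta, rightShift_delta]

theorem commute_leftShift_rightShift (γ δ : Γ) : Commute (leftShift p γ) (rightShift p δ) := by
  ext x η
  change x _ = x _
  simp [mul_assoc]

theorem commute_leftConv_rightShift (f : ZG Γ) (δ : Γ) :
    Commute (leftConv p f) (rightShift p δ) := by
  rw [leftConv_eq_sum]
  exact Commute.sum_left _ _ _ fun γ _ => (commute_leftShift_rightShift γ δ).smul_left _

theorem commute_rightConv {A : lp (fun _ : Γ => ℝ) p →L[ℝ] lp (fun _ : Γ => ℝ) p}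
    (hA : ∀ γ, Commute A (rightShift p γ)) (f : ZG Γ) : Commute A (rightConv p f) :=
  Commute.sum_right _ _ _ fun γ _ => (hA γ).smul_right _

theorem leftConv_single_delta (f : ZG Γ) (γ : Γ) :
    leftConv p f (delta p γ) = leftConv p (f * MonoidAlgebra.single γ 1) (delta p 1) := by
  rw [map_mul]
  simp [leftConv, leftShift_delta]

theorem rightConv_delta (f : ZG Γ) (γ : Γ) :
    rightConv p f (delta p γ) = leftConv p (MonoidAlgebra.single γ 1 * f) (delta p 1) := by
  have h := DFunLike.congr_fun
    (commute_rightConv (commute_leftShift_rightShift γ) f).eq (delta p 1)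
  simp only [mul_apply_eq_comp, leftShift_delta, mul_one,
    rightConv_delta_one] at h
  rw [map_mul, ← h]
  simp [leftConv]

theorem leftConv_delta_one_apply (f : ZG Γ) (δ : Γ) :
    leftConv p f (delta p 1) δ = f.coeff δ := by
  classical
  rw [leftConv_apply, Finsupp.sum_eq_single δ] <;> simp +contextual [delta_apply, inv_mul_eq_one]

/-- Factoring out the translation by the dominant `γ₀` leaves the scalar `g_{γ₀}` plus an operator
of smaller norm, since translations are isometries; such a sum is invertible. -/
theorem isUnit_leftConv {g : ZG Γ} (hg : IsLopsided g) : IsUnit (leftConv p g) := by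
  classical
  obtain ⟨γ₀, h⟩ := hg
  set B := ∑ γ ∈ g.coeff.support \ {γ₀}, g.coeff γ • leftShift p (γ₀⁻¹ * γ) with hB
  have h0 : γ₀ ∈ g.coeff.support := by
    rw [Finsupp.mem_support_iff]
    rintro h0
    rw [h0, abs_zero] at h
    exact h.not_ge (Finset.sum_nonneg fun _ _ => abs_nonneg _)
  have hnorm : ‖-B‖ < ‖(g.coeff γ₀ : ℝ)‖ := by
    rw [norm_neg]
    calc ‖B‖ ≤ ∑ γ ∈ g.coeff.support \ {γ₀}, |(g.coeff γ : ℝ)| := by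
          refine norm_sum_le_of_le _ fun γ _ => ?_
          rw [← Int.cast_smul_eq_zsmul ℝ, norm_smul, Real.norm_eq_abs]
          exact mul_le_of_le_one_right (abs_nonneg _) (norm_permHom_le _)
      _ < _ := by
          rw [Real.norm_eq_abs]
          exact_mod_cast h
  have hone : ‖(1 : lp (fun _ : Γ => ℝ) p →L[ℝ] lp (fun _ : Γ => ℝ) p)‖ ≤ 1 :=
    ContinuousLinearMap.norm_id_le
  have hu : IsUnit (algebraMap ℝ (lp (fun _ : Γ => ℝ) p →L[ℝ] lp (fun _ : Γ => ℝ) p)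
      (g.coeff γ₀) - -B) := by
    have := spectrum.mem_resolventSet_of_norm_lt_mul (𝕜 := ℝ) (a := -B) (k := (g.coeff γ₀ : ℝ))
      ((mul_le_of_le_one_right (norm_nonneg _) hone).trans_lt hnorm)
    exact this
  have hfac : leftConv p g = leftShift p γ₀ *
      (algebraMap ℝ (lp (fun _ : Γ => ℝ) p →L[ℝ] lp (fun _ : Γ => ℝ) p)
      (g.coeff γ₀) - -B) := by
    rw [leftConv_eq_sum, Finsupp.sum, ← Finset.sdiff_union_of_subset
      (Finset.singleton_subset_iff.2 h0), Finset.sum_union Finset.sdiff_disjoint,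
      sub_neg_eq_add, mul_add, hB, Finset.mul_sum, add_comm]
    congr 1
    · rw [Finset.sum_singleton, Algebra.algebraMap_eq_smul_one, mul_smul_comm, mul_one,
        Int.cast_smul_eq_zsmul]
    · refine Finset.sum_congr rfl fun γ _ => ?_
      rw [mul_smul_comm, ← map_mul, mul_inv_cancel_left]
  rw [hfac]
  exact ((Group.isUnit γ₀).map _).mul hu

end Operators

/-! ### Direct finiteness through the trace on `ℓ²` -/

section DirectFiniteness

variable {Γ : Type*} [Group Γ]

theorem inner_rightShift (γ : Γ) (x y : lp (fun _ : Γ => ℝ) 2) :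
    inner ℝ (rightShift 2 γ x) (rightShift 2 γ y) = inner ℝ x y :=
  (permIsometry 2 (Equiv.mulRight γ)).inner_map_map x y

theorem rightShift_inv_apply {p : ℝ≥0∞} [Fact (1 ≤ p)] (γ : Γ) (x : lp (fun _ : Γ => ℝ) p) :
    rightShift p γ (rightShift p γ⁻¹ x) = x := by
  ext δ
  simp [rightShift_apply]

/-- The translations are unitary and `K` is invariant under their inverses too, so the orthogonal
complement is also invariant. -/
theorem commute_starProjection_rightShift (K : Submodule ℝ (lp (fun _ : Γ => ℝ) 2))
    [K.HasOrthogonalProjection] (hK : ∀ γ, ∀ x ∈ K, rightShift 2 γ x ∈ K) (γ : Γ) :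
    Commute K.starProjection (rightShift 2 γ) := by
  ext1 x
  change K.starProjection (rightShift 2 γ x) = rightShift 2 γ (K.starProjection x)
  refine Submodule.eq_starProjection_of_mem_of_inner_eq_zero
    (hK γ _ (Submodule.starProjection_apply_mem _ _)) fun y hy => ?_
  rw [← map_sub, ← rightShift_inv_apply γ y, inner_rightShift]
  exact Submodule.starProjection_inner_eq_zero _ _ (hK _ _ hy)

omit [Group Γ] in
theorem inner_delta (γ : Γ) (x : lp (fun _ : Γ => ℝ) 2) : inner ℝ x (delta 2 γ) = x γ := by
  classical
  rw [delta, lp.inner_single_right]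
  simp

/-- Direct finiteness: a left inverse, in the commutant of the right translations of `ℓ²`, of the
left convolution by an element of `ℤ[Γ]` is also a right inverse. -/
theorem leftConv_apply_of_leftInverse {f : ZG Γ}
    {W : lp (fun _ : Γ => ℝ) 2 →L[ℝ] lp (fun _ : Γ => ℝ) 2}
    (hW : ∀ γ, Commute W (rightShift 2 γ)) (h : W * leftConv 2 f = 1) :
    leftConv 2 f (W (delta 2 1)) = delta 2 1 := by
  set T := leftConv (Γ := Γ) 2 f with hT
  have hWT : ∀ x, W (T x) = x := fun x => DFunLike.congr_fun h x
  have hTR : ∀ γ, Commute T (rightShift 2 γ) := commute_leftConv_rightShift f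
  -- As `W T = 1`, the operator `T W` is idempotent and `K` is the range of `T`. The aim is `δ₁ ∈
  -- K`.
  let K : Submodule ℝ (lp (fun _ : Γ => ℝ) 2) := LinearMap.ker (1 - T * W).toLinearMap
  have hmem : ∀ x, x ∈ K ↔ T (W x) = x := fun x => by
    change x - T (W x) = 0 ↔ _
    rw [sub_eq_zero, eq_comm]
  have : CompleteSpace K := (ContinuousLinearMap.isClosed_ker (1 - T * W)).completeSpace_coe
  have hK : ∀ γ, ∀ x ∈ K, rightShift 2 γ x ∈ K := by
    intro γ x hx
    rw [hmem] at hx ⊢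
    have h1 := DFunLike.congr_fun ((hTR γ).mul_left (hW γ)).eq x
    exact h1.trans (congrArg (rightShift 2 γ) hx)
  set P := K.starProjection with hP
  have hPR : ∀ γ, Commute P (rightShift 2 γ) := commute_starProjection_rightShift K hK
  have hPT : ∀ x, P (T x) = T x := fun x =>
    Submodule.starProjection_eq_self_iff.2 ((hmem _).2 (by rw [hWT]))
  have hmemP : P (delta 2 1) ∈ K := Submodule.starProjection_apply_mem _ _
  -- `P = T W P` and `P T = T`, so `τ(P) = τ(T W P) = τ(W P T) = τ(W T) = 1`.
  have htrace : P (delta 2 1) 1 = 1 := by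
    rw [← (hmem _).1 hmemP, hT, ← rightConv_apply_one]
    have h1 := DFunLike.congr_fun
      (commute_rightConv (fun γ => (hW γ).mul_left (hPR γ)) f).eq (delta 2 1)
    change W (P (rightConv 2 f (delta 2 1))) = rightConv 2 f (W (P (delta 2 1))) at h1
    rw [← h1, rightConv_delta_one, ← hT, hPT, hWT]
    classical
    simp [delta_apply]
  -- By orthogonality `‖δ₁ - P δ₁‖² = ⟨δ₁ - P δ₁, δ₁⟩ = 1 - τ(P) = 0`.
  have hzero : delta 2 1 - P (delta 2 1) = 0 := by
    rw [← inner_self_eq_zero (𝕜 := ℝ), inner_sub_right,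
      Submodule.starProjection_inner_eq_zero _ _ hmemP, sub_zero, inner_delta]
    classical
    simp [delta_apply, htrace]
  rw [← hmem, sub_eq_zero.1 hzero]
  exact hmemP

/-- An element of `ℤ[Γ]` with a lopsided left multiple is invertible in `ℓ¹`. -/
theorem invertibleInL1_of_isLopsided {f h : ZG Γ} (hl : IsLopsided (h * f)) :
    InvertibleInL1 f := by
  have : Fact ((1 : ℝ≥0∞) ≤ 1) := ⟨le_rfl⟩
  have hcomm : ∀ (p : ℝ≥0∞) [Fact (1 ≤ p)]
      (u : (lp (fun _ : Γ => ℝ) p →L[ℝ] lp (fun _ : Γ => ℝ) p)ˣ), ↑u = leftConv p (h * f) →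
      ∀ γ, Commute (↑u⁻¹ * leftConv p h) (rightShift p γ) := by
    intro p _ u hu γ
    refine Commute.mul_left (Commute.units_inv_left ?_) (commute_leftConv_rightShift _ _)
    rw [hu]
    exact commute_leftConv_rightShift _ _
  have hinv : ∀ (p : ℝ≥0∞) [Fact (1 ≤ p)]
      (u : (lp (fun _ : Γ => ℝ) p →L[ℝ] lp (fun _ : Γ => ℝ) p)ˣ), ↑u = leftConv p (h * f) →
      ↑u⁻¹ * leftConv p h * leftConv p f = 1 := by
    intro p _ u hu
    rw [mul_assoc, ← map_mul, ← hu, Units.inv_mul]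
  obtain ⟨u, hu⟩ := isUnit_leftConv (p := 1) hl
  obtain ⟨u', hu'⟩ := isUnit_leftConv (p := 2) hl
  set w : lp (fun _ : Γ => ℝ) 1 := (↑u⁻¹ * leftConv 1 h) (delta 1 1) with hw
  set w' : lp (fun _ : Γ => ℝ) 2 := (↑u'⁻¹ * leftConv 2 h) (delta 2 1) with hw'
  have hright : leftConv 2 f w' = delta 2 1 :=
    leftConv_apply_of_leftInverse (hcomm 2 u' hu') (hinv 2 u' hu')
  -- The `ℓ²` argument must be brought back to `ℓ¹ ⊆ ℓ²`: both families solve `(h * f) * x = h`,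
  -- whose solution in `ℓ²` is unique.
  have hww' : (w : Γ → ℝ) = w' := by
    let w₂ : lp (fun _ : Γ => ℝ) 2 := ⟨w, (lp.memℓp w).of_exponent_ge one_le_two⟩
    have h1 : leftConv 1 (h * f) w = leftConv 1 h (delta 1 1) := by
      rw [← hu, hw, ← mul_apply_eq_comp, ← mul_assoc, Units.mul_inv, one_mul]
    have h2 : leftConv 2 (h * f) w' = leftConv 2 h (delta 2 1) := by
      rw [← hu', hw', ← mul_apply_eq_comp, ← mul_assoc, Units.mul_inv, one_mul]
    have h3 : leftConv 2 (h * f) w₂ = leftConv 2 (h * f) w' := by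
      rw [h2]
      ext δ
      have h4 : leftConv 2 (h * f) w₂ δ = leftConv 1 (h * f) w δ := by
        rw [leftConv_apply, leftConv_apply]
      rw [h4, h1, leftConv_delta_one_apply, leftConv_delta_one_apply]
    have h5 : w₂ = w' := by
      have h6 := congrArg (↑u'⁻¹ : lp (fun _ : Γ => ℝ) 2 →L[ℝ] lp (fun _ : Γ => ℝ) 2) h3
      simpa only [← hu', ← mul_apply_eq_comp, Units.inv_mul, one_apply_eq_self] using h6
    exact congrArg (fun x : lp (fun _ : Γ => ℝ) 2 => (x : Γ → ℝ)) h5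
  refine ⟨w, ?_, ?_⟩
  · rw [hww', conv_coeffs_left, hright, coeffs_one]
  · rw [conv_coeffs_right, coeffs_one (p := 1)]
    have h1 := DFunLike.congr_fun (commute_rightConv (hcomm 1 u hu) f).eq (delta 1 1)
    change (↑u⁻¹ * leftConv 1 h) (rightConv 1 f (delta 1 1)) = rightConv 1 f w at h1
    rw [← h1, rightConv_delta_one, ← mul_apply_eq_comp, hinv 1 u hu]
    rfl

end DirectFiniteness

/-! ### Lopsided elements by rounding coefficients -/

section Rounding

variable {Γ : Type*} [Group Γ]

/-- Real combinations of the values of an additive map on the basis of `ℤ[Γ]` are approximated,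
up to scaling, by values of the map. -/
theorem exists_norm_sub_natCast_smul_lt {E : Type*} [NormedAddCommGroup E] [NormedSpace ℝ E]
    (φ : ZG Γ →+ E) {x : E}
    (hx : x ∈ closure
      (Submodule.span ℝ (Set.range fun γ => φ (MonoidAlgebra.single γ 1)) : Set E))
    {ε : ℝ} (hε : 0 < ε) :
    ∃ N : ℕ, ∃ h : ZG Γ, ‖φ h - (N : ℝ) • x‖ < ε * N := by
  obtain ⟨y, hy, hxy⟩ := Metric.mem_closure_iff.1 hx (ε / 2) (half_pos hε)
  obtain ⟨c, rfl⟩ := (Finsupp.mem_span_range_iff_exists_finsupp).1 hy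
  set C := ∑ γ ∈ c.support, ‖φ (MonoidAlgebra.single γ 1)‖ with hC
  -- Rounding costs at most `C` whatever `N` is, so a large `N` makes it less than `N * ε / 2`.
  obtain ⟨N, hN⟩ := exists_nat_gt (2 * C / ε)
  have hC0 : 0 ≤ C := Finset.sum_nonneg fun _ _ => norm_nonneg _
  have hN0 : (0 : ℝ) < N := lt_of_le_of_lt (by positivity) hN
  refine ⟨N, ∑ γ ∈ c.support, round (N * c γ) • MonoidAlgebra.single γ 1, ?_⟩
  have h1 : ‖φ (∑ γ ∈ c.support, round (N * c γ) • MonoidAlgebra.single γ 1)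
      - (N : ℝ) • c.sum fun γ a => a • φ (MonoidAlgebra.single γ 1)‖ ≤ C := by
    rw [map_sum, Finsupp.sum, Finset.smul_sum, ← Finset.sum_sub_distrib]
    refine norm_sum_le_of_le _ fun γ _ => ?_
    rw [map_zsmul, ← Int.cast_smul_eq_zsmul ℝ, smul_smul, ← sub_smul, norm_smul,
      Real.norm_eq_abs, abs_sub_comm]
    exact mul_le_of_le_one_left (norm_nonneg _) ((abs_sub_round _).trans (by norm_num))
  have h2 : ‖(N : ℝ) • (c.sum fun γ a => a • φ (MonoidAlgebra.single γ 1)) - (N : ℝ) • x‖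
      ≤ N * (ε / 2) := by
    rw [← smul_sub, norm_smul, Real.norm_natCast, ← dist_eq_norm, dist_comm]
    exact mul_le_mul_of_nonneg_left hxy.le hN0.le
  have h3 := norm_sub_le_norm_sub_add_norm_sub
    (φ (∑ γ ∈ c.support, round (N * c γ) • MonoidAlgebra.single γ 1))
    ((N : ℝ) • c.sum fun γ a => a • φ (MonoidAlgebra.single γ 1)) ((N : ℝ) • x)
  rw [div_lt_iff₀ hε] at hN
  linarith

theorem isLopsided_of_norm_sub_lt {g : ZG Γ} {N : ℕ}
    (h : ‖leftConv 1 g (delta 1 1) - (N : ℝ) • delta 1 1‖ < N) : IsLopsided g := by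
  classical
  refine ⟨1, ?_⟩
  set z : lp (fun _ : Γ => ℝ) 1 := leftConv 1 g (delta 1 1) - (N : ℝ) • delta 1 1 with hz
  -- The index 1 is inserted since it may lie outside the support. The bound becomes `|g₁ - N| +
  -- ∑_{γ ≠ 1} |g_γ| < N`, and `N - |g₁ - N| ≤ |g₁|`.
  have h1 := lp.sum_rpow_le_norm_rpow (p := 1) (by simp) z (insert 1 (g.coeff.support \ {1}))
  have hval : ∀ γ, z γ = (g.coeff γ : ℝ) - N * if γ = 1 then 1 else 0 := by
    intro γ
    rw [← leftConv_delta_one_apply (p := 1), ← delta_apply]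
    rfl
  simp only [ENNReal.toReal_one, Real.rpow_one] at h1
  rw [Finset.sum_insert (by simp)] at h1
  have h2 : ∑ γ ∈ g.coeff.support \ {1}, ‖z γ‖
      = ∑ γ ∈ g.coeff.support \ {1}, |(g.coeff γ : ℝ)| := by
    refine Finset.sum_congr rfl fun γ hγ => ?_
    have : γ ≠ 1 := by simpa using (Finset.mem_sdiff.1 hγ).2
    rw [hval, if_neg this, mul_zero, sub_zero, Real.norm_eq_abs]
  rw [h2, hval, if_pos rfl, mul_one, Real.norm_eq_abs] at h1
  have h3 := abs_sub_abs_le_abs_sub (N : ℝ) (g.coeff 1)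
  rw [abs_sub_comm, Nat.abs_cast] at h3
  have h4 : ∑ γ ∈ g.coeff.support \ {1}, |(g.coeff γ : ℝ)| < |(g.coeff 1 : ℝ)| := by linarith
  exact_mod_cast h4

theorem exists_isLopsided_mul_left {f : ZG Γ}
    (hf : delta 1 1 ∈ closure (Submodule.span ℝ (Set.range fun γ =>
      leftConv 1 (MonoidAlgebra.single γ 1 * f) (delta 1 1)) : Set (lp (fun _ : Γ => ℝ) 1))) :
    ∃ h : ZG Γ, IsLopsided (h * f) := by
  let φ : ZG Γ →+ lp (fun _ : Γ => ℝ) 1 :=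
    { toFun h := leftConv 1 (h * f) (delta 1 1)
      map_zero' := by simp
      map_add' := by simp [add_mul] }
  obtain ⟨N, h, hh⟩ := exists_norm_sub_natCast_smul_lt φ hf one_pos
  exact ⟨h, isLopsided_of_norm_sub_lt (hh.trans_eq (one_mul _))⟩

theorem exists_isLopsided_mul_right {f : ZG Γ}
    (hf : delta 1 1 ∈ closure (Submodule.span ℝ (Set.range fun γ =>
      leftConv 1 (f * MonoidAlgebra.single γ 1) (delta 1 1)) : Set (lp (fun _ : Γ => ℝ) 1))) :
    ∃ h : ZG Γ, IsLopsided (f * h) := by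
  let φ : ZG Γ →+ lp (fun _ : Γ => ℝ) 1 :=
    { toFun h := leftConv 1 (f * h) (delta 1 1)
      map_zero' := by simp
      map_add' := by simp [mul_add] }
  obtain ⟨N, h, hh⟩ := exists_norm_sub_natCast_smul_lt φ hf one_pos
  exact ⟨h, isLopsided_of_norm_sub_lt (hh.trans_eq (one_mul _))⟩

omit [Group Γ] in
-- Finitely supported families are dense in `ℓ¹`. Applied to convolution by `f`, this places `w * f`
-- and `f * w` in the closures of the one-sided ideals.
theorem map_mem_closure_span (A : lp (fun _ : Γ => ℝ) 1 →L[ℝ] lp (fun _ : Γ => ℝ) 1)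
    (w : lp (fun _ : Γ => ℝ) 1) :
    A w ∈ closure (Submodule.span ℝ (Set.range fun γ => A (delta 1 γ)) :
      Set (lp (fun _ : Γ => ℝ) 1)) := by
  classical
  refine mem_closure_of_tendsto (A.hasSum (lp.hasSum_single ENNReal.one_ne_top w))
    (Filter.Eventually.of_forall fun s => Submodule.sum_mem _ fun γ _ => ?_)
  have h : lp.single 1 γ (w γ) = w γ • delta (Γ := Γ) 1 γ := by
    ext δ
    simp [delta_apply, lp.single_apply, Pi.single_apply]
  rw [h, map_smul]
  exact Submodule.smul_mem _ _ (Submodule.subset_span ⟨γ, rfl⟩)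

theorem InvertibleInL1.exists_isLopsided {f : ZG Γ} (hf : InvertibleInL1 f) :
    (∃ h : ZG Γ, IsLopsided (h * f)) ∧ ∃ h : ZG Γ, IsLopsided (f * h) := by
  obtain ⟨w, h1, h2⟩ := hf
  rw [conv_coeffs_left, coeffs_one (p := 1)] at h1
  rw [conv_coeffs_right, coeffs_one (p := 1)] at h2
  constructor
  · apply exists_isLopsided_mul_left
    simp_rw [← rightConv_delta]
    rw [← lp.ext h2]
    exact map_mem_closure_span _ _
  · apply exists_isLopsided_mul_right
    simp_rw [← leftConv_single_delta]
    rw [← lp.ext h1]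
    exact map_mem_closure_span _ _

end Rounding

/-! ### Bounded solutions and duality with `ℓ¹` -/

section Bounded

variable {Γ : Type*} [Group Γ]

/-- The action of `Γ` on `A^Γ` by right shifts. -/
def rightRegular (Γ A : Type*) [Group Γ] [AddCommGroup A] :
    Γ →* AddMonoid.End (Γ → A) where
  toFun γ :=
    { toFun x := fun δ => x (δ * γ)
      map_zero' := rfl
      map_add' _ _ := rfl }
  map_one' := by ext x δ; exact congrArg x (mul_one δ)
  map_mul' γ γ' := by ext x δ; exact congrArg x (mul_assoc δ γ γ').symm

theorem rho_eq_lift {A : Type*} [AddCommGroup A] (f : ZG Γ) :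
    rho (A := A) f = MonoidAlgebra.lift ℤ (AddMonoid.End (Γ → A)) Γ (rightRegular Γ A) f := by
  rw [MonoidAlgebra.lift_apply]
  ext x δ
  exact ((congrFun (AddMonoidHom.finsetSum_apply
    (fun γ => (f.coeff γ • rightRegular Γ A γ : (Γ → A) →+ (Γ → A))) f.coeff.support x) δ).trans
    (Finset.sum_apply _ _ _)).symm

theorem rho_mul {A : Type*} [AddCommGroup A] (g f : ZG Γ) (x : Γ → A) :
    rho (g * f) x = rho g (rho f x) := by
  simp only [rho_eq_lift, map_mul]
  rfl

theorem mem_KInfty {f : ZG Γ} {v : lp (fun _ : Γ => ℂ) ∞} :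
    v ∈ KInfty f ↔ rho f (v : Γ → ℂ) = 0 := by
  rw [rho_eq_conv_adjoint]
  rfl

/-- Solving the equation for the dominant term bounds `‖v‖` by a constant less than 1 times `‖v‖`.
-/
theorem KInfty_eq_bot_of_isLopsided {g : ZG Γ} (hg : IsLopsided g) : KInfty g = ⊥ := by
  classical
  rw [Submodule.eq_bot_iff]
  intro v hv
  rw [mem_KInfty] at hv
  obtain ⟨γ₀, h⟩ := hg
  set S := ∑ γ ∈ g.coeff.support \ {γ₀}, |g.coeff γ| with hS
  have hS0 : 0 ≤ S := Finset.sum_nonneg fun _ _ => abs_nonneg _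
  have h0 : γ₀ ∈ g.coeff.support := by
    rw [Finsupp.mem_support_iff]
    rintro h0
    rw [h0, abs_zero] at h
    exact h.not_ge hS0
  have hpos : (0 : ℝ) < |(g.coeff γ₀ : ℝ)| := by exact_mod_cast hS0.trans_lt h
  have hv' : ∀ δ, |(g.coeff γ₀ : ℝ)| * ‖v (δ * γ₀)‖ ≤ S * ‖v‖ := by
    intro δ
    have h1 : ∑ γ ∈ g.coeff.support, g.coeff γ • v (δ * γ) = 0 := congrFun hv δ
    rw [← Finset.sdiff_union_of_subset (Finset.singleton_subset_iff.2 h0),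
      Finset.sum_union Finset.sdiff_disjoint, Finset.sum_singleton, add_comm] at h1
    have hn : ∀ γ, ‖g.coeff γ • v (δ * γ)‖ = |(g.coeff γ : ℝ)| * ‖v (δ * γ)‖ := fun γ => by
      rw [zsmul_eq_mul, norm_mul, Complex.norm_intCast]
    rw [← hn, eq_neg_of_add_eq_zero_left h1, norm_neg, hS, Int.cast_sum, Finset.sum_mul]
    refine norm_sum_le_of_le _ fun γ _ => ?_
    rw [hn, Int.cast_abs]
    exact mul_le_mul_of_nonneg_left (lp.norm_apply_le_norm ENNReal.top_ne_zero _ _) (abs_nonneg _)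
  have hle : ‖v‖ ≤ S * ‖v‖ / |(g.coeff γ₀ : ℝ)| := by
    refine lp.norm_le_of_forall_le (by positivity) fun δ => ?_
    rw [le_div_iff₀' hpos]
    simpa using hv' (δ * γ₀⁻¹)
  rw [le_div_iff₀ hpos] at hle
  have hlt : (S : ℝ) < |(g.coeff γ₀ : ℝ)| := by exact_mod_cast h
  by_contra hne
  have : 0 < ‖v‖ := norm_pos_iff.2 hne
  nlinarith

theorem KInfty_le_mul (h f : ZG Γ) : KInfty f ≤ KInfty (h * f) := by
  intro v hv
  rw [mem_KInfty] at hv ⊢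
  rw [rho_mul, hv, map_zero]

/-- Triviality of `K_∞(f)` makes the left ideal generated by `f` dense in `ℓ¹`. -/
theorem delta_mem_closure_of_KInfty_eq_bot {f : ZG Γ} (hf : KInfty f = ⊥) :
    delta 1 1 ∈ closure (Submodule.span ℝ (Set.range fun γ =>
      leftConv 1 (MonoidAlgebra.single γ 1 * f) (delta 1 1)) : Set (lp (fun _ : Γ => ℝ) 1)) := by
  by_contra hnot
  set S := Submodule.span ℝ (Set.range fun γ =>
    leftConv 1 (MonoidAlgebra.single γ 1 * f) (delta (Γ := Γ) 1 1)) with hS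
  obtain ⟨φ, u, hφ, hu⟩ := geometric_hahn_banach_closed_point (S.convex.closure) isClosed_closure
    hnot
  have hzero : ∀ y ∈ S, φ y = 0 := by
    intro y hy
    by_contra hne
    -- A functional bounded above on a subspace vanishes there: this multiple of `y` would attain
    -- the strict bound `u`.
    have h1 := hφ ((u / φ y) • y) (subset_closure (S.smul_mem _ hy))
    rw [map_smul, smul_eq_mul, div_mul_cancel₀ _ hne] at h1
    exact h1.false
  have hmem : Memℓp (fun γ => ((φ (delta 1 γ) : ℝ) : ℂ)) ∞ := by
    refine memℓp_infty ⟨‖φ‖, ?_⟩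
    rintro _ ⟨γ, rfl⟩
    classical
    have h1 : ‖delta (Γ := Γ) 1 γ‖ = 1 := by
      rw [delta, lp.norm_single one_pos, norm_one]
    simpa [h1] using φ.le_opNorm (delta 1 γ)
  have hK : (⟨_, hmem⟩ : lp (fun _ : Γ => ℂ) ∞) ∈ KInfty f := by
    rw [mem_KInfty]
    ext δ
    change (f.coeff.sum fun γ n => n • ((φ (delta 1 (δ * γ)) : ℝ) : ℂ)) = 0
    have h1 := hzero _ (Submodule.subset_span ⟨δ, rfl⟩)
    beta_reduce at h1
    rw [← rightConv_delta, rightConv, Finsupp.sum, sum_apply, map_sum] at h1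
    simp only [smul_apply, rightShift_delta, map_zsmul] at h1
    rw [Finsupp.sum]
    exact_mod_cast congrArg (fun r : ℝ => (r : ℂ)) h1
  rw [hf, Submodule.mem_bot] at hK
  have h1 : φ (delta 1 1) = 0 := by
    have : ((φ (delta 1 1) : ℝ) : ℂ) = 0 :=
      congrArg (fun v : lp (fun _ : Γ => ℂ) ∞ => v 1) hK
    exact_mod_cast this
  have h2 := hφ 0 (subset_closure S.zero_mem)
  rw [map_zero] at h2
  linarith

end Bounded

/-! ### Expansiveness and bounded solutions -/

section Expansiveness

variable {Γ : Type*} [Group Γ]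

theorem rho_comp {A B : Type*} [AddCommGroup A] [AddCommGroup B] (φ : A →+ B) (f : ZG Γ)
    (x : Γ → A) : rho f (fun δ => φ (x δ)) = fun δ => φ (rho f x δ) := by
  ext δ
  simp [rho, Finsupp.sum, map_sum]

/-- The projection `ℝ → ℝ/ℤ`. -/
def circleHom : ℝ →+ UnitAddCircle := QuotientAddGroup.mk' _

theorem exists_circleHom_eq (t : UnitAddCircle) : ∃ r : ℝ, circleHom r = t ∧ |r| = ‖t‖ := by
  obtain ⟨r, rfl⟩ := QuotientAddGroup.mk_surjective t
  refine ⟨r - round r, ?_, (UnitAddCircle.norm_eq).symm⟩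
  rw [map_sub, sub_eq_self.2]
  · rfl
  · exact (AddCircle.coe_eq_zero_iff 1).2 ⟨round r, by simp⟩

theorem circleHom_eq_zero_iff {r : ℝ} : circleHom r = 0 ↔ ∃ n : ℤ, (n : ℝ) = r := by
  refine (AddCircle.coe_eq_zero_iff (1 : ℝ) (x := r)).trans ?_
  simp_rw [zsmul_eq_mul, mul_one]

theorem eq_zero_of_circleHom_eq_zero {r : ℝ} (h : circleHom r = 0) (hr : |r| < 1) : r = 0 := by
  obtain ⟨n, rfl⟩ := circleHom_eq_zero_iff.1 h
  have h1 : |n| < 1 := by exact_mod_cast hr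
  rw [Int.abs_lt_one_iff.1 h1, Int.cast_zero]

theorem norm_circleHom_le (r : ℝ) : ‖circleHom r‖ ≤ |r| := by
  change ‖((r : ℝ) : UnitAddCircle)‖ ≤ _
  rw [UnitAddCircle.norm_eq]
  simpa using round_le r 0

theorem rho_re {f : ZG Γ} {v : Γ → ℂ} (hv : rho f v = 0) : rho f (fun δ => (v δ).re) = 0 := by
  have h := rho_comp Complex.reAddGroupHom f v
  rw [hv] at h
  exact h.trans (by ext; simp)

theorem rho_im {f : ZG Γ} {v : Γ → ℂ} (hv : rho f v = 0) : rho f (fun δ => (v δ).im) = 0 := by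
  have h := rho_comp Complex.imAddGroupHom f v
  rw [hv] at h
  exact h.trans (by ext; simp)

theorem isExpansive_of_KInfty_eq_bot [Countable Γ] {f : ZG Γ} (hf : KInfty f = ⊥) :
    (principalAction f).IsExpansive := by
  set C : ℝ := ∑ γ ∈ f.coeff.support, |(f.coeff γ : ℝ)| with hC
  have hC0 : 0 ≤ C := Finset.sum_nonneg fun _ _ => abs_nonneg _
  -- Chosen so that `C * ε < 1`, which forces the integer values of `ρ^f r` to be zero.
  set ε : ℝ := 1 / (C + 1) with hε
  have hε0 : 0 < ε := by positivity
  have hcont : Continuous fun x : X f => x.1 1 := (continuous_apply 1).comp continuous_subtype_val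
  refine ⟨{x | ‖x.1 1‖ < ε}, ?_, Set.eq_singleton_iff_unique_mem.2 ⟨?_, ?_⟩⟩
  · exact (isOpen_lt hcont.norm continuous_const).mem_nhds (by simpa using hε0)
  · exact Set.mem_iInter.2 fun γ => ⟨0, by simpa using hε0, map_zero _⟩
  intro x hx
  have hsmall : ∀ δ, ‖x.1 δ‖ < ε := by
    intro δ
    obtain ⟨u, hu, rfl⟩ := Set.mem_iInter.1 hx δ
    change ‖u.1 (δ⁻¹ * δ)‖ < ε
    rw [inv_mul_cancel]
    exact hu
  choose r hr hrn using fun δ => exists_circleHom_eq (x.1 δ)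
  have hrε : ∀ δ, |r δ| < ε := fun δ => hrn δ ▸ hsmall δ
  have hrho : rho f r = 0 := by
    ext δ
    refine eq_zero_of_circleHom_eq_zero ?_ ?_
    · have h1 := congrFun (rho_comp circleHom f r) δ
      simp_rw [hr] at h1
      rw [← h1]
      exact congrFun (show rho f x.1 = 0 from x.2) δ
    · calc |rho f r δ| ≤ ∑ γ ∈ f.coeff.support, |(f.coeff γ : ℝ)| * ε := by
            refine norm_sum_le_of_le (f := fun γ => f.coeff γ • r (δ * γ)) _ fun γ _ => ?_
            rw [zsmul_eq_mul, norm_mul]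
            exact mul_le_mul_of_nonneg_left (hrε _).le (abs_nonneg _)
        _ = C * ε := (Finset.sum_mul _ _ _).symm
        _ < 1 := by
            rw [hε, mul_one_div, div_lt_one (by positivity)]
            linarith
  have hmem : Memℓp (fun δ => (r δ : ℂ)) ∞ := by
    refine memℓp_infty ⟨ε, ?_⟩
    rintro _ ⟨δ, rfl⟩
    simpa using (hrε δ).le
  have hK : (⟨_, hmem⟩ : lp (fun _ : Γ => ℂ) ∞) ∈ KInfty f := by
    rw [mem_KInfty]
    refine (rho_comp Complex.ofRealHom.toAddMonoidHom f r).trans ?_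
    rw [hrho]
    ext
    simp
  rw [hf, Submodule.mem_bot] at hK
  ext δ
  have h1 : (r δ : ℂ) = 0 := congrArg (fun v : lp (fun _ : Γ => ℂ) ∞ => v δ) hK
  rw [← hr, Complex.ofReal_eq_zero.1 h1, map_zero]
  rfl

theorem exists_forall_norm_lt_mem {f : ZG Γ} {U : Set (X f)} (hU : U ∈ 𝓝 0) :
    ∃ ε > 0, ∀ x : X f, (∀ δ, ‖x.1 δ‖ < ε) → x ∈ U := by
  obtain ⟨V, hV, hVU⟩ := mem_nhds_induced (Subtype.val : X f → Γ → UnitAddCircle) 0 U |>.1 hU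
  rw [nhds_pi, Filter.mem_pi] at hV
  obtain ⟨I, hI, t, ht, htV⟩ := hV
  have hev : ∀ᶠ ε in 𝓝[>] (0 : ℝ), ∀ i ∈ I, Metric.ball 0 ε ⊆ t i := by
    rw [Filter.eventually_all_finite hI]
    intro i _
    obtain ⟨r, hr, hrt⟩ := Metric.mem_nhds_iff.1 (ht i)
    filter_upwards [Ioo_mem_nhdsGT hr] with ε hε
    exact (Metric.ball_subset_ball hε.2.le).trans hrt
  obtain ⟨ε, hε, hpos⟩ := (hev.and self_mem_nhdsWithin).exists
  refine ⟨ε, hpos, fun x hx => hVU (htV fun i hi => hε i hi ?_)⟩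
  rw [mem_ball_zero_iff]
  exact hx i

theorem eq_zero_of_isExpansive [Countable Γ] {f : ZG Γ} (hf : (principalAction f).IsExpansive)
    {u : Γ → ℝ} {C : ℝ} (hu : ∀ δ, |u δ| ≤ C) (hrho : rho f u = 0) : u = 0 := by
  obtain ⟨U, hU, hUf⟩ := hf
  obtain ⟨ε, hε, hεU⟩ := exists_forall_norm_lt_mem hU
  have hC : 0 ≤ C := (abs_nonneg _).trans (hu 1)
  -- The bound `ε` keeps every translate of the projected point in `U`; the bound 1 lets `c * u` be
  -- recovered as zero from its class modulo `ℤ`.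
  set c := min ε 1 / (C + 1) with hc
  have hm : 0 < min ε 1 := lt_min hε one_pos
  have hc0 : 0 < c := by positivity
  have hsmall : ∀ δ, |c * u δ| < min ε 1 := by
    intro δ
    rw [abs_mul, abs_of_pos hc0]
    calc c * |u δ| ≤ c * C := mul_le_mul_of_nonneg_left (hu δ) hc0.le
      _ < c * (C + 1) := by gcongr; linarith
      _ = min ε 1 := div_mul_cancel₀ _ (by positivity)
  have hx : (fun δ => circleHom (c * u δ)) ∈ X f := by
    change rho f _ = 0
    refine (rho_comp (circleHom.comp (AddMonoidHom.mulLeft c)) f u).trans ?_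
    rw [hrho]
    ext
    simp
  have hmem : (⟨_, hx⟩ : X f) ∈ ⋂ γ : Γ, ((principalAction f).aut γ) '' U := by
    refine Set.mem_iInter.2 fun γ => ⟨((principalAction f).aut γ).symm ⟨_, hx⟩, hεU _ fun δ => ?_,
      ((principalAction f).aut γ).apply_symm_apply _⟩
    exact (norm_circleHom_le _).trans_lt ((hsmall _).trans_le (min_le_left _ _))
  rw [hUf, Set.mem_singleton_iff] at hmem
  ext δ
  have h1 : circleHom (c * u δ) = 0 := congrFun (congrArg Subtype.val hmem) δ
  have h2 := eq_zero_of_circleHom_eq_zero h1 ((hsmall δ).trans_le (min_le_right _ _))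
  exact (mul_eq_zero.1 h2).resolve_left hc0.ne'

theorem KInfty_eq_bot_of_isExpansive [Countable Γ] {f : ZG Γ}
    (hf : (principalAction f).IsExpansive) : KInfty f = ⊥ := by
  rw [Submodule.eq_bot_iff]
  intro v hv
  rw [mem_KInfty] at hv
  have hn : ∀ δ, ‖v δ‖ ≤ ‖v‖ := lp.norm_apply_le_norm ENNReal.top_ne_zero v
  have hre := eq_zero_of_isExpansive hf
    (fun δ => (Complex.abs_re_le_norm _).trans (hn δ)) (rho_re hv)
  have him := eq_zero_of_isExpansive hf
    (fun δ => (Complex.abs_im_le_norm _).trans (hn δ)) (rho_im hv)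
  ext δ
  exact Complex.ext (congrFun hre δ) (congrFun him δ)

end Expansiveness

end

end GroupRingDynamics

theorem theorem2p1 {Γ : Type*} [Group Γ] [Countable Γ] [Infinite Γ]
    (f : GroupRingDynamics.ZG Γ) :
    List.TFAE [
      (GroupRingDynamics.principalAction f).IsExpansive,
      GroupRingDynamics.InvertibleInL1 f,
      GroupRingDynamics.KInfty f = ⊥,
      (∃ h : GroupRingDynamics.ZG Γ, GroupRingDynamics.IsLopsided (h * f)) ∧
        (∃ h : GroupRingDynamics.ZG Γ, GroupRingDynamics.IsLopsided (f * h))] := by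
  open GroupRingDynamics in
  tfae_have 1 → 3 := KInfty_eq_bot_of_isExpansive
  tfae_have 3 → 1 := isExpansive_of_KInfty_eq_bot
  tfae_have 2 → 4 := InvertibleInL1.exists_isLopsided
  tfae_have 3 → 2 := fun h =>
    (exists_isLopsided_mul_left (delta_mem_closure_of_KInfty_eq_bot h)).elim
      fun _ => invertibleInL1_of_isLopsided
  tfae_have 4 → 3 := by
    rintro ⟨⟨h, hh⟩, -⟩
    exact eq_bot_iff.2 ((KInfty_le_mul h f).trans (KInfty_eq_bot_of_isLopsided hh).le)
  tfae_finish
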